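/- Let $n\ge 1$, let $U\subset\mathbb C$ be open (a coordinate domain, with coordinate $z$) and let $\varphi_1,\dots,\varphi_n$ be smooth ($C^\infty$ in the real sense) complex-valued functions on $U$ with $\sum_i\varphi_i=0$. Write $\partial=\partial/\partial z$, $\bar\partial=\partial/\partial\bar z$, let $E_{i,j}$ be the matrix units, and consider the local Toda connection $D=D'+D''$ on the trivial bundle of rank $n$, $$D'=\partial+\sum_{i=1}^{n}\partial\varphi_i\,E_{i,i}+\sum_{i=1}^{n-1}E_{i,i+1},\qquad D''=\bar\partial+\sum_{i=1}^{n-1}e^{\varphi_i-\varphi_{i+1}}E_{i+1,i}.$$ The Toda equations are $$\partial\bar\partial\,\mathrm{diag}(\varphi_1,\dots,\varphi_n)=\sum_{i=1}^{n-1}e^{\varphi_i-\varphi_{i+1}}\,(E_{i,i}-E_{i+1,i+1}).$$ For functions $w_2,\dots,w_n$ on $U$, the W-form connection $\nabla=\nabla_w$ is $$\nabla'=\partial+\sum_{i=1}^{n-1}E_{i,i+1}+\sum_{j=1}^{n-1}w_{n+1-j}\,E_{n,j},\qquad \nabla''=\bar\partial .$$ A gauge transformation $G$ maps a connection $d+A$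 to $d+A^G$ with $A^G=G^{-1}AG+G^{-1}dG$. The lower nilpotent subgroup of $SL(n,\mathbb C)$ is the group of lower triangular matrices with ones on the diagonal. 1. If the Toda equations hold on $U$, then there are smooth gauge transformations $G_1,\dots,G_{n-1}$ on $U$ with values in the lower nilpotent subgroup of $SL(n,\mathbb C)$, of the form $G_k=\exp\sum_{j=k+1}^{n}g^{(k)}_jE_{j,k}$ with smooth functions $g^{(k)}_j$, and holomorphic functions $w_2,\dots,w_n$ on $U$, such that the product $G=G_1G_2\cdots G_{n-1}$ maps $D$ to $\nabla_w$ on $U$. 2. The Toda equations are the integrability conditions of this system: conversely, if there are any smooth gauge transformations $G_1,\dots,G_{n-1}$ on $U$ with values in the lower nilpotent subgroup and any functions $w_2,\dots,w_n$ on $U$ such that $G=G_1\cdots G_{n-1}$ maps $D$ to $\nabla_w$ on $U$, then the Toda equations hold on $U$. Moreover, the Toda equations hold on $U$ if and only if $D$ is flat on $U$, i.e. $\partial A_{\bar z}-\bar\partial A_z+[A_z,A_{\bar z}]=0$, where $A_z$ and $A_{\bar z}$ are the connection matrices of $D'=\partial+A_z$ and $D''=\bar\partial+A_{\bar z}$.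 -/

import Mathlib

open scoped Matrix ContDiff

noncomputable section

namespace Toda

/-- The Wirtinger derivative `∂ = ∂/∂z` (for functions that are differentiable over `ℝ`). -/
def dz (f : ℂ → ℂ) (z : ℂ) : ℂ :=
  (1 / 2) * (fderiv ℝ f z 1 - Complex.I * fderiv ℝ f z Complex.I)

/-- The Wirtinger derivative `∂̄ = ∂/∂z̄` (for functions that are differentiable over `ℝ`). -/
def dzbar (f : ℂ → ℂ) (z : ℂ) : ℂ :=
  (1 / 2) * (fderiv ℝ f z 1 + Complex.I * fderiv ℝ f z Complex.I)

/-- `r` is the rank of `sl(n, ℂ)`, so that `n = r + 1`; rows and columns are indexed by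
`Fin (r + 1)`, simple roots by `Fin r`. -/
abbrev Mat (r : ℕ) : Type := Matrix (Fin (r + 1)) (Fin (r + 1)) ℂ

abbrev SLn (r : ℕ) : Type := Matrix.SpecialLinearGroup (Fin (r + 1)) ℂ

/-- Entrywise `∂` of a matrix-valued function. -/
def matDz {r : ℕ} (M : ℂ → Mat r) (z : ℂ) : Mat r :=
  Matrix.of fun i j => dz (fun x => M x i j) z

/-- Entrywise `∂̄` of a matrix-valued function. -/
def matDzbar {r : ℕ} (M : ℂ → Mat r) (z : ℂ) : Mat r :=
  Matrix.of fun i j => dzbar (fun x => M x i j) z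

/-- A connection on a trivialized rank `r + 1` bundle over a coordinate domain, given by its
connection matrices: `D' = ∂ + A10 dz`, `D'' = ∂̄ + A01 dz̄`. -/
structure LocalConnection (r : ℕ) where
  A10 : ℂ → Mat r
  A01 : ℂ → Mat r

/-- Equality of two connections over `U`. -/
def LocalConnection.EqOn {r : ℕ} (D E : LocalConnection r) (U : Set ℂ) : Prop :=
  Set.EqOn D.A10 E.A10 U ∧ Set.EqOn D.A01 E.A01 U

/-- The image of `D` under a gauge transformation: `A ↦ G⁻¹ A G + G⁻¹ dG`. -/
def LocalConnection.gauge {r : ℕ} (D : LocalConnection r) (G : ℂ → SLn r) :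
    LocalConnection r where
  A10 z := ((G z)⁻¹ : SLn r).1 * D.A10 z * (G z).1
    + ((G z)⁻¹ : SLn r).1 * matDz (fun x => (G x).1) z
  A01 z := ((G z)⁻¹ : SLn r).1 * D.A01 z * (G z).1
    + ((G z)⁻¹ : SLn r).1 * matDzbar (fun x => (G x).1) z

/-- The coefficient `F_{z z̄} = ∂ A_{z̄} - ∂̄ A_z + [A_z, A_{z̄}]` of the curvature. -/
def LocalConnection.curvature {r : ℕ} (D : LocalConnection r) (z : ℂ) : Mat r :=
  matDz D.A01 z - matDzbar D.A10 z + (D.A10 z * D.A01 z - D.A01 z * D.A10 z)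

/-- The Toda connection: `D'` has `∂φ_i` on the diagonal and `1` above it, `D''` has
`exp (φ_i - φ_{i+1})` below the diagonal. -/
def todaConnection {r : ℕ} (φ : Fin (r + 1) → ℂ → ℂ) : LocalConnection r where
  A10 z := Matrix.diagonal (fun i => dz (φ i) z)
    + ∑ i : Fin r, Matrix.single i.castSucc i.succ 1
  A01 z := ∑ i : Fin r,
    Matrix.single i.succ i.castSucc (Complex.exp (φ i.castSucc z - φ i.succ z))

/-- The Toda equations `∂ ∂̄ Φ = ∑ h_i exp (α_i(Φ))` over `U`, for `Φ = diag φ`,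
`h_i = E_{i,i} - E_{i+1,i+1}` and `α_i(Φ) = φ_i - φ_{i+1}`. -/
def TodaEquations {r : ℕ} (U : Set ℂ) (φ : Fin (r + 1) → ℂ → ℂ) : Prop :=
  ∀ z ∈ U, (Matrix.diagonal (fun i => dz (dzbar (φ i)) z) : Mat r) =
    ∑ i : Fin r, Complex.exp (φ i.castSucc z - φ i.succ z) •
      (Matrix.single i.castSucc i.castSucc 1 - Matrix.single i.succ i.succ 1)

/-- The W (Drinfel'd-Sokolov) form `∇' = ∂ + (…)`, `∇'' = ∂̄`: ones above the diagonal and last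
row `(w_n, w_{n-1}, …, w_2, 0)`, where `n = r + 1`; only `w_2, …, w_n` occur. -/
def wConnection (r : ℕ) (w : ℕ → ℂ → ℂ) : LocalConnection r where
  A10 z := (∑ i : Fin r, Matrix.single i.castSucc i.succ 1)
    + (∑ j : Fin r, Matrix.single (Fin.last r) j.castSucc (w (r + 1 - j.val) z))
  A01 _ := 0

/-- The lower nilpotent subgroup of `SL(r + 1, ℂ)`: lower triangular matrices with ones on the
diagonal. -/
def lowerNilpotent (r : ℕ) : Subgroup (SLn r) where
  carrier := {g | (∀ i, g.1 i i = 1) ∧ ∀ i j, i < j → g.1 i j = 0}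
  one_mem' := ⟨fun i => by simp, fun i j h => by simp [h.ne]⟩
  mul_mem' := by
    rintro a b ⟨ha, ha'⟩ ⟨hb, hb'⟩
    refine ⟨fun i => ?_, fun i j h => ?_⟩
    · rw [Matrix.SpecialLinearGroup.coe_mul, Matrix.mul_apply, Finset.sum_eq_single i]
      · rw [ha, hb, one_mul]
      · intro k _ hk
        rcases lt_or_gt_of_ne hk with h | h
        · rw [hb' k i h, mul_zero]
        · rw [ha' i k h, zero_mul]
      · simp
    · rw [Matrix.SpecialLinearGroup.coe_mul, Matrix.mul_apply]
      refine Finset.sum_eq_zero fun k _ => ?_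
      rcases lt_or_ge i k with h1 | h1
      · rw [ha' i k h1, zero_mul]
      · rw [hb' k j (lt_of_le_of_lt h1 h), mul_zero]
  inv_mem' := by
    rintro a ⟨ha, ha'⟩
    have hab : ∀ i j, (a.1 * (a⁻¹).1) i j = (1 : Mat r) i j := fun i j => by
      rw [← Matrix.SpecialLinearGroup.coe_mul, mul_inv_cancel, Matrix.SpecialLinearGroup.coe_one]
    have key : ∀ i j, i ≤ j → (a⁻¹).1 i j = (1 : Mat r) i j := by
      intro i
      induction i using WellFoundedLT.induction with
      | ind i ih =>
        intro j hij
        have h := hab i j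
        rw [Matrix.mul_apply, Finset.sum_eq_single i] at h
        · rwa [ha, one_mul] at h
        · intro k _ hk
          rcases lt_or_gt_of_ne hk with h1 | h1
          · rw [ih k h1 j (h1.le.trans hij), Matrix.one_apply_ne (h1.trans_le hij).ne, mul_zero]
          · rw [ha' i k h1, zero_mul]
        · simp
    exact ⟨fun i => by rw [key i i le_rfl, Matrix.one_apply_eq],
      fun i j h => by rw [key i j h.le, Matrix.one_apply_ne h.ne]⟩

/-- Over `U`, `G` is a smooth (`C^∞` in the real sense) gauge transformation with values in the
lower nilpotent subgroup of `SL(r + 1, ℂ)`. -/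
def IsLowerNilpotentGauge {r : ℕ} (U : Set ℂ) (G : ℂ → SLn r) : Prop :=
  (∀ i j, ContDiffOn ℝ ∞ (fun z => (G z).1 i j) U) ∧ ∀ z ∈ U, G z ∈ lowerNilpotent r

/-- Over `U`, `G = exp (∑_{j > k} g_j E_{j,k})` with smooth functions `g_j`. -/
def IsColumnGauge {r : ℕ} (U : Set ℂ) (k : Fin r) (G : ℂ → SLn r) : Prop :=
  ∃ g : Fin (r + 1) → ℂ → ℂ, (∀ j, ContDiffOn ℝ ∞ (g j) U) ∧
    ∀ z ∈ U, (G z).1 =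
      NormedSpace.exp (∑ j ∈ Finset.Ioi k.castSucc, Matrix.single j k.castSucc (g j z) : Mat r)

/-- The ordered product `G_1 G_2 ⋯ G_{n-1}`, where `n = r + 1`. -/
def orderedProd {r : ℕ} (G : Fin r → ℂ → SLn r) (z : ℂ) : SLn r :=
  (List.ofFn fun k => G k z).prod

end Toda

end

/-!
Write `G` for the product of the column gauges. Since the `k`-th factor differs from the identity
only in its `k`-th column, below the diagonal, the product in increasing order is the lower
unipotent matrix having these columns (`coe_orderedProd_columnGauge`), so the task is to find a
lower unipotent `G` with `A G + ∂G = G W` and `B G + ∂̄G = 0`, where `A`, `B` are the Toda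
connection matrices and `W` is the W-form matrix (`gauge_eqOn_iff`).

Row by row, the first equation reads `g_{i+1} = shift g_i - (∂ + ∂φ_i) g_i`, except in the last
row. So it is solved algebraically, starting from `g_0 = (1, 0, …, 0)` (`gaugeRow`), and its last
row defines the functions `w`; the last entry of that row is consistent because `∑ ∂φ_i = 0`
(`toda_A10_mul_gaugeMatrix`). The second equation, `∂̄ g_{i+1} = -exp (φ_i - φ_{i+1}) g_i`, follows
from the Toda equations by induction on `i` (`dzbar_gaugeRow`).

The rest is a curvature computation. Let `F` be the curvature of the Toda connection, which is
diagonal and vanishes exactly when the Toda equations hold (`curvature_toda`). For any gauge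
transformation `G` into W-form, `F G = -G ∂̄W` (`curvature_mul_gauge`). If `F = 0` this says that
the `w` are holomorphic. Conversely, `∂̄W` has only a last row, with last entry `0`, so for `G`
lower unipotent and `F` diagonal the identity forces `F = 0` (`diagonal_eq_zero_of_mul_eq`).
-/

namespace Toda

/-! ### Wirtinger derivatives -/

/-- The operator `(∂ₓ + a ∂ᵧ) / 2`; it is `∂` for `a = -i` and `∂̄` for `a = i`, so that the
calculus of both Wirtinger derivatives is developed at once. -/
noncomputable def wirt (a : ℂ) (f : ℂ → ℂ) (z : ℂ) : ℂ :=
  (1 / 2) * (fderiv ℝ f z 1 + a * fderiv ℝ f z Complex.I)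

theorem dz_eq_wirt : dz = wirt (-Complex.I) := by
  funext f z
  simp only [dz, wirt]
  ring

theorem dzbar_eq_wirt : dzbar = wirt Complex.I := rfl

variable {U : Set ℂ} {a : ℂ} {f g : ℂ → ℂ} {z : ℂ}

theorem wirt_const (a c : ℂ) (z : ℂ) : wirt a (fun _ => c) z = 0 := by
  simp [wirt]

theorem wirt_congr (hU : IsOpen U) (hz : z ∈ U) (h : ∀ x ∈ U, f x = g x) :
    wirt a f z = wirt a g z := by
  have : f =ᶠ[nhds z] g := Filter.eventuallyEq_of_mem (hU.mem_nhds hz) h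
  simp only [wirt, this.fderiv_eq]

theorem wirt_add (hf : DifferentiableAt ℝ f z) (hg : DifferentiableAt ℝ g z) :
    wirt a (fun x => f x + g x) z = wirt a f z + wirt a g z := by
  simp only [wirt, fderiv_fun_add hf hg, add_apply]
  ring

theorem wirt_sub (hf : DifferentiableAt ℝ f z) (hg : DifferentiableAt ℝ g z) :
    wirt a (fun x => f x - g x) z = wirt a f z - wirt a g z := by
  simp only [wirt, fderiv_fun_sub hf hg, sub_apply]
  ring

theorem wirt_neg : wirt a (fun x => -f x) z = -wirt a f z := by
  simp only [wirt, fderiv_fun_neg, neg_apply]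
  ring

theorem wirt_mul (hf : DifferentiableAt ℝ f z) (hg : DifferentiableAt ℝ g z) :
    wirt a (fun x => f x * g x) z = wirt a f z * g z + f z * wirt a g z := by
  simp only [wirt, fderiv_fun_mul hf hg, add_apply, smul_apply, smul_eq_mul]
  ring

theorem wirt_sum {ι : Type*} (s : Finset ι) {F : ι → ℂ → ℂ}
    (hF : ∀ i ∈ s, DifferentiableAt ℝ (F i) z) :
    wirt a (fun x => ∑ i ∈ s, F i x) z = ∑ i ∈ s, wirt a (F i) z := by
  simp only [wirt, fderiv_fun_sum hF, sum_apply, Finset.mul_sum,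
    ← Finset.sum_add_distrib]

theorem wirt_cexp (hf : DifferentiableAt ℝ f z) :
    wirt a (fun x => Complex.exp (f x)) z = Complex.exp (f z) * wirt a f z := by
  simp only [wirt, hf.hasFDerivAt.cexp.fderiv, smul_apply, smul_eq_mul]
  ring

theorem differentiableAt_of_smooth (hU : IsOpen U) (hf : ContDiffOn ℝ ∞ f U) (hz : z ∈ U) :
    DifferentiableAt ℝ f z :=
  (hf.differentiableOn (by simp)).differentiableAt (hU.mem_nhds hz)

theorem contDiffOn_wirt (hU : IsOpen U) (hf : ContDiffOn ℝ ∞ f U) (a : ℂ) :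
    ContDiffOn ℝ ∞ (wirt a f) U := by
  have h : ContDiffOn ℝ ∞ (fderiv ℝ f) U := hf.fderiv_of_isOpen hU (by simp)
  exact contDiffOn_const.mul ((h.clm_apply contDiffOn_const).add
    (contDiffOn_const.mul (h.clm_apply contDiffOn_const)))

/-- Symmetry of the second derivative. -/
theorem wirt_comm (hU : IsOpen U) (hf : ContDiffOn ℝ ∞ f U) (hz : z ∈ U) (a b : ℂ) :
    wirt a (wirt b f) z = wirt b (wirt a f) z := by
  have h : DifferentiableAt ℝ (fderiv ℝ f) z :=
    ((hf.fderiv_of_isOpen hU (m := ∞) (by simp)).differentiableOn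
      (by simp)).differentiableAt (hU.mem_nhds hz)
  have key : ∀ c v : ℂ, fderiv ℝ (wirt c f) z v =
      (1 / 2) * (fderiv ℝ (fderiv ℝ f) z v 1 + c * fderiv ℝ (fderiv ℝ f) z v Complex.I) := by
    intro c v
    have e : ∀ u : ℂ, HasFDerivAt (fun x => fderiv ℝ f x u)
        ((fderiv ℝ (fderiv ℝ f) z).flip u) z := fun u => by
      simpa using h.hasFDerivAt.clm_apply (hasFDerivAt_const u z)
    have e2 := (((e 1).add ((e Complex.I).const_mul c)).const_mul (1 / 2 : ℂ)).fderiv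
    have e3 : fderiv ℝ (wirt c f) z v = _ := DFunLike.congr_fun e2 v
    rw [e3]
    simp
    ring
  have hs : IsSymmSndFDerivAt ℝ f z :=
    ((hf.contDiffAt (hU.mem_nhds hz)).isSymmSndFDerivAt (by
      rw [minSmoothness_of_isRCLikeNormedField]
      exact WithTop.coe_le_coe.2 (le_top : (2 : ℕ∞) ≤ ⊤)))
  have := hs.eq 1 Complex.I
  simp only [wirt] at key ⊢
  simp only [key, this]
  ring

/-- Cauchy–Riemann: a real-differentiable solution of `∂̄ f = 0` is holomorphic. -/
theorem differentiableOn_of_dzbar_eq_zero (hU : IsOpen U) (hf : ContDiffOn ℝ ∞ f U)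
    (h : ∀ z ∈ U, dzbar f z = 0) : DifferentiableOn ℂ f U := by
  intro z hz
  refine (differentiableAt_complex_iff_differentiableAt_real.2
    ⟨differentiableAt_of_smooth hU hf hz, ?_⟩).differentiableWithinAt
  have := h z hz
  simp only [dzbar] at this
  rw [smul_eq_mul]
  linear_combination (-2 * Complex.I) * this + fderiv ℝ f z Complex.I * Complex.I_sq

/-! ### Smooth matrix-valued functions -/

/-- The entries of `M` are smooth over `U`. -/
def MatSmooth {r : ℕ} (U : Set ℂ) (M : ℂ → Mat r) : Prop :=
  ∀ i j, ContDiffOn ℝ ∞ (fun z => M z i j) U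

/-- The entrywise operator `(∂ₓ + a ∂ᵧ) / 2`. -/
noncomputable def matWirt {r : ℕ} (a : ℂ) (M : ℂ → Mat r) (z : ℂ) : Mat r :=
  Matrix.of fun i j => wirt a (fun x => M x i j) z

variable {r : ℕ} {M N : ℂ → Mat r}

theorem matDz_eq_matWirt (M : ℂ → Mat r) : matDz M = matWirt (-Complex.I) M := by
  simp only [funext_iff, matDz, matWirt, dz_eq_wirt, implies_true]

theorem matDzbar_eq_matWirt (M : ℂ → Mat r) : matDzbar M = matWirt Complex.I M := rfl

theorem matWirt_congr (hU : IsOpen U) (hz : z ∈ U) (h : ∀ x ∈ U, M x = N x) :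
    matWirt a M z = matWirt a N z := by
  ext i j
  exact wirt_congr hU hz fun x hx => by rw [h x hx]

theorem MatSmooth.mul (hM : MatSmooth U M) (hN : MatSmooth U N) :
    MatSmooth U fun z => M z * N z := by
  intro i j
  simp only [Matrix.mul_apply]
  exact ContDiffOn.sum fun k _ => (hM i k).mul (hN k j)

theorem MatSmooth.add (hM : MatSmooth U M) (hN : MatSmooth U N) :
    MatSmooth U fun z => M z + N z :=
  fun i j => (hM i j).add (hN i j)

theorem MatSmooth.sub (hM : MatSmooth U M) (hN : MatSmooth U N) :
    MatSmooth U fun z => M z - N z :=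
  fun i j => (hM i j).sub (hN i j)

theorem matSmooth_const (M : Mat r) : MatSmooth U fun _ => M :=
  fun _ _ => contDiffOn_const

theorem MatSmooth.matWirt (hU : IsOpen U) (hM : MatSmooth U M) (a : ℂ) :
    MatSmooth U (matWirt a M) :=
  fun i j => contDiffOn_wirt hU (hM i j) a

theorem matWirt_add (hU : IsOpen U) (hz : z ∈ U) (hM : MatSmooth U M) (hN : MatSmooth U N) :
    matWirt a (fun x => M x + N x) z = matWirt a M z + matWirt a N z := by
  ext i j
  exact wirt_add (differentiableAt_of_smooth hU (hM i j) hz)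
    (differentiableAt_of_smooth hU (hN i j) hz)

theorem matWirt_mul (hU : IsOpen U) (hz : z ∈ U) (hM : MatSmooth U M) (hN : MatSmooth U N) :
    matWirt a (fun x => M x * N x) z = matWirt a M z * N z + M z * matWirt a N z := by
  ext i j
  have hM' := fun i j => differentiableAt_of_smooth hU (hM i j) hz
  have hN' := fun i j => differentiableAt_of_smooth hU (hN i j) hz
  simp only [matWirt, Matrix.of_apply, Matrix.add_apply, Matrix.mul_apply]
  rw [wirt_sum _ fun k _ => (hM' i k).fun_mul (hN' k j), ← Finset.sum_add_distrib]
  exact Finset.sum_congr rfl fun k _ => wirt_mul (hM' i k) (hN' k j)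

theorem matWirt_comm (hU : IsOpen U) (hz : z ∈ U) (hM : MatSmooth U M) (a b : ℂ) :
    matWirt a (matWirt b M) z = matWirt b (matWirt a M) z := by
  ext i j
  exact wirt_comm hU (hM i j) hz a b

theorem matWirt_zero : matWirt a (fun _ => (0 : Mat r)) z = 0 := by
  ext i j
  exact wirt_const a 0 z

/-! ### Gauge transformations and curvature -/

/-- The equation `E = D.gauge G` cleared of the inverse of `G`. -/
theorem gauge_eqOn_iff {D E : LocalConnection r} {G : ℂ → SLn r} :
    (D.gauge G).EqOn E U ↔ ∀ z ∈ U,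
      D.A10 z * (G z).1 + matDz (fun x => (G x).1) z = (G z).1 * E.A10 z ∧
      D.A01 z * (G z).1 + matDzbar (fun x => (G x).1) z = (G z).1 * E.A01 z := by
  have key : ∀ (g : SLn r) (X Y Z : Mat r),
      (g⁻¹).1 * X * g.1 + (g⁻¹).1 * Y = Z ↔ X * g.1 + Y = g.1 * Z := by
    intro g X Y Z
    have h1 : (g⁻¹).1 * g.1 = 1 := by
      rw [← Matrix.SpecialLinearGroup.coe_mul, inv_mul_cancel, Matrix.SpecialLinearGroup.coe_one]
    have h2 : g.1 * (g⁻¹).1 = 1 := by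
      rw [← Matrix.SpecialLinearGroup.coe_mul, mul_inv_cancel, Matrix.SpecialLinearGroup.coe_one]
    rw [Matrix.mul_assoc, ← Matrix.mul_add]
    constructor
    · rintro rfl
      rw [← Matrix.mul_assoc, h2, Matrix.one_mul]
    · intro h
      rw [h, ← Matrix.mul_assoc, h1, Matrix.one_mul]
  simp only [LocalConnection.EqOn, Set.EqOn, LocalConnection.gauge, key]
  exact ⟨fun h z hz => ⟨h.1 hz, h.2 hz⟩, fun h => ⟨fun z hz => (h z hz).1, fun z hz => (h z hz).2⟩⟩

/-- If `G` takes `(∂ + A, ∂̄ + B)` to `(∂ + W, ∂̄)`, whose curvature is `-∂̄ W`, then the curvature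
`F` of the former satisfies `F G = -G ∂̄ W`. -/
theorem curvature_mul_gauge (hU : IsOpen U) {D : LocalConnection r} (hA : MatSmooth U D.A10)
    (hB : MatSmooth U D.A01) {G W : ℂ → Mat r} (hG : MatSmooth U G) (hW : MatSmooth U W)
    (h10 : ∀ z ∈ U, D.A10 z * G z + matDz G z = G z * W z)
    (h01 : ∀ z ∈ U, D.A01 z * G z + matDzbar G z = 0) (hz : z ∈ U) :
    D.curvature z * G z = -(G z * matDzbar W z) := by
  simp only [LocalConnection.curvature, matDz_eq_matWirt, matDzbar_eq_matWirt] at *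
  have e1 : matWirt Complex.I (fun x => D.A10 x * G x + matWirt (-Complex.I) G x) z =
      matWirt Complex.I (fun x => G x * W x) z := matWirt_congr hU hz h10
  have e2 : matWirt (-Complex.I) (fun x => D.A01 x * G x + matWirt Complex.I G x) z =
      matWirt (-Complex.I) (fun _ => 0) z := matWirt_congr hU hz h01
  rw [matWirt_add hU hz (hA.mul hG) (hG.matWirt hU _), matWirt_mul hU hz hA hG,
    matWirt_mul hU hz hG hW] at e1
  rw [matWirt_add hU hz (hB.mul hG) (hG.matWirt hU _), matWirt_mul hU hz hB hG,
    matWirt_zero, matWirt_comm hU hz hG] at e2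
  have f1 : matWirt (-Complex.I) G z = G z * W z - D.A10 z * G z := by
    rw [← h10 z hz]; abel
  have f2 : matWirt Complex.I G z = -(D.A01 z * G z) := by
    rw [eq_neg_iff_add_eq_zero, ← h01 z hz, add_comm]
  rw [f2] at e1
  rw [f1] at e2
  have e3 := congrArg₂ (· - ·) e2 e1
  rw [← sub_eq_zero] at e3 ⊢
  rw [← e3]
  noncomm_ring

/-! ### Entries of the connection matrices -/

/-- The principal nilpotent matrix, with ones above the diagonal. -/
def upShift (r : ℕ) : Mat r := ∑ i : Fin r, Matrix.single i.castSucc i.succ 1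

/-- The matrix with `c` below the diagonal. -/
def subdiag (c : Fin r → ℂ) : Mat r := ∑ i : Fin r, Matrix.single i.succ i.castSucc (c i)

/-- The matrix with last row `(v, 0)`. -/
def lastRow (v : Fin r → ℂ) : Mat r :=
  ∑ j : Fin r, Matrix.single (Fin.last r) j.castSucc (v j)

theorem todaConnection_A10 (φ : Fin (r + 1) → ℂ → ℂ) (z : ℂ) :
    (todaConnection φ).A10 z = Matrix.diagonal (fun i => dz (φ i) z) + upShift r := rfl

theorem todaConnection_A01 (φ : Fin (r + 1) → ℂ → ℂ) (z : ℂ) :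
    (todaConnection φ).A01 z =
      subdiag fun i => Complex.exp (φ i.castSucc z - φ i.succ z) := rfl

theorem wConnection_A10 (w : ℕ → ℂ → ℂ) (z : ℂ) :
    (wConnection r w).A10 z = upShift r + lastRow fun j => w (r + 1 - j.val) z := rfl

theorem upShift_mul_castSucc (M : Mat r) (i : Fin r) (j : Fin (r + 1)) :
    (upShift r * M) i.castSucc j = M i.succ j := by
  rw [upShift, Matrix.sum_mul, Matrix.sum_apply, Finset.sum_eq_single i]
  · simp
  · intro k _ hk
    exact Matrix.single_mul_apply_of_ne _ _ _ _ _ (by simpa using hk.symm) _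
  · simp

theorem upShift_mul_last (M : Mat r) (j : Fin (r + 1)) :
    (upShift r * M) (Fin.last r) j = 0 := by
  rw [upShift, Matrix.sum_mul, Matrix.sum_apply]
  exact Finset.sum_eq_zero fun k _ =>
    Matrix.single_mul_apply_of_ne _ _ _ _ _ (Fin.castSucc_lt_last k).ne' _

theorem mul_upShift_zero (M : Mat r) (i : Fin (r + 1)) : (M * upShift r) i 0 = 0 := by
  rw [upShift, Matrix.mul_sum, Matrix.sum_apply]
  exact Finset.sum_eq_zero fun k _ =>
    Matrix.mul_single_apply_of_ne _ _ _ _ _ (Fin.succ_ne_zero k).symm _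

theorem mul_upShift_succ (M : Mat r) (i : Fin (r + 1)) (j : Fin r) :
    (M * upShift r) i j.succ = M i j.castSucc := by
  rw [upShift, Matrix.mul_sum, Matrix.sum_apply, Finset.sum_eq_single j]
  · simp
  · intro k _ hk
    exact Matrix.mul_single_apply_of_ne _ _ _ _ _ (by simpa using hk.symm) _
  · simp

theorem subdiag_mul_zero (c : Fin r → ℂ) (M : Mat r) (j : Fin (r + 1)) :
    (subdiag c * M) 0 j = 0 := by
  rw [subdiag, Matrix.sum_mul, Matrix.sum_apply]
  exact Finset.sum_eq_zero fun k _ =>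
    Matrix.single_mul_apply_of_ne _ _ _ _ _ (Fin.succ_ne_zero k).symm _

theorem subdiag_mul_succ (c : Fin r → ℂ) (M : Mat r) (i : Fin r) (j : Fin (r + 1)) :
    (subdiag c * M) i.succ j = c i * M i.castSucc j := by
  rw [subdiag, Matrix.sum_mul, Matrix.sum_apply, Finset.sum_eq_single i]
  · simp
  · intro k _ hk
    exact Matrix.single_mul_apply_of_ne _ _ _ _ _ (by simpa using hk.symm) _
  · simp

theorem mul_lastRow_last (v : Fin r → ℂ) (M : Mat r) (i : Fin (r + 1)) :
    (M * lastRow v) i (Fin.last r) = 0 := by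
  rw [lastRow, Matrix.mul_sum, Matrix.sum_apply]
  exact Finset.sum_eq_zero fun k _ =>
    Matrix.mul_single_apply_of_ne _ _ _ _ _ (Fin.castSucc_lt_last k).ne' _

theorem mul_lastRow_castSucc (v : Fin r → ℂ) (M : Mat r) (i : Fin (r + 1)) (j : Fin r) :
    (M * lastRow v) i j.castSucc = M i (Fin.last r) * v j := by
  rw [lastRow, Matrix.mul_sum, Matrix.sum_apply, Finset.sum_eq_single j]
  · simp
  · intro k _ hk
    exact Matrix.mul_single_apply_of_ne _ _ _ _ _ (by simpa using hk.symm) _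
  · simp

theorem lastRow_apply_last (v : Fin r → ℂ) (i : Fin (r + 1)) : lastRow v i (Fin.last r) = 0 := by
  simpa using mul_lastRow_last v 1 i

theorem lastRow_apply_of_ne (v : Fin r → ℂ) {i : Fin (r + 1)} (hi : i ≠ Fin.last r)
    (j : Fin (r + 1)) : lastRow v i j = 0 := by
  induction j using Fin.lastCases with
  | last => exact lastRow_apply_last v i
  | cast j =>
    have := mul_lastRow_castSucc v 1 i j
    rwa [Matrix.one_mul, Matrix.one_apply_ne hi, zero_mul] at this

theorem lastRow_apply_castSucc (v : Fin r → ℂ) (j : Fin r) :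
    lastRow v (Fin.last r) j.castSucc = v j := by
  simpa using mul_lastRow_castSucc v 1 (Fin.last r) j

theorem matSmooth_toda_A10 (hU : IsOpen U) {φ : Fin (r + 1) → ℂ → ℂ}
    (hφ : ∀ i, ContDiffOn ℝ ∞ (φ i) U) : MatSmooth U (todaConnection φ).A10 := by
  refine MatSmooth.add (fun i j => ?_) (matSmooth_const (upShift r))
  rcases eq_or_ne i j with rfl | hij
  · simpa only [Matrix.diagonal_apply_eq, dz_eq_wirt] using contDiffOn_wirt hU (hφ i) _
  · simpa only [Matrix.diagonal_apply_ne _ hij] using contDiffOn_const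

theorem matSmooth_subdiag {c : Fin r → ℂ → ℂ} (hc : ∀ i, ContDiffOn ℝ ∞ (c i) U) :
    MatSmooth U fun z => subdiag fun i => c i z := by
  intro i j
  simp only [subdiag, Matrix.sum_apply, Matrix.single_apply]
  refine ContDiffOn.sum fun k _ => ?_
  split_ifs
  · exact hc k
  · exact contDiffOn_const

theorem matSmooth_lastRow {v : Fin r → ℂ → ℂ} (hv : ∀ i, ContDiffOn ℝ ∞ (v i) U) :
    MatSmooth U fun z => lastRow fun i => v i z := by
  intro i j
  simp only [lastRow, Matrix.sum_apply, Matrix.single_apply]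
  refine ContDiffOn.sum fun k _ => ?_
  split_ifs
  · exact hv k
  · exact contDiffOn_const

theorem matSmooth_toda_A01 {φ : Fin (r + 1) → ℂ → ℂ}
    (hφ : ∀ i, ContDiffOn ℝ ∞ (φ i) U) : MatSmooth U (todaConnection φ).A01 :=
  matSmooth_subdiag fun i => ((hφ i.castSucc).sub (hφ i.succ)).cexp

theorem matDzbar_wConnection (w : ℕ → ℂ → ℂ) (z : ℂ) :
    matDzbar (wConnection r w).A10 z = lastRow fun j => dzbar (w (r + 1 - j.val)) z := by
  ext i j
  have e : ∀ c : ℂ, ∀ f : ℂ → ℂ, dzbar (fun x => c + f x) z = dzbar f z := by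
    intro c f
    simp [dzbar, fderiv_const_add]
  simp only [matDzbar, Matrix.of_apply, wConnection_A10, Matrix.add_apply, e]
  by_cases hi : i = Fin.last r
  · subst hi
    induction j using Fin.lastCases with
    | last =>
      simp only [lastRow_apply_last]
      exact wirt_const _ _ _
    | cast j => simp only [lastRow_apply_castSucc]
  · simp only [lastRow_apply_of_ne _ hi]
    exact wirt_const _ _ _

/-! ### The curvature of the Toda connection -/

/-- The off-diagonal part of the curvature cancels because
`∂ exp (φ_i - φ_{i+1}) = (∂φ_i - ∂φ_{i+1}) exp (φ_i - φ_{i+1})`. -/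
theorem curvature_toda (hU : IsOpen U) {φ : Fin (r + 1) → ℂ → ℂ}
    (hφ : ∀ i, ContDiffOn ℝ ∞ (φ i) U) (hz : z ∈ U) :
    (todaConnection φ).curvature z =
      ∑ i : Fin r, Complex.exp (φ i.castSucc z - φ i.succ z) •
        (Matrix.single i.castSucc i.castSucc 1 - Matrix.single i.succ i.succ 1)
      - Matrix.diagonal (fun i => dz (dzbar (φ i)) z) := by
  set c : Fin r → ℂ → ℂ := fun i z => Complex.exp (φ i.castSucc z - φ i.succ z) with hc
  have hd := fun i => differentiableAt_of_smooth hU (hφ i) hz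
  have h1 : matDz (todaConnection φ).A01 z =
      subdiag fun i => c i z * (dz (φ i.castSucc) z - dz (φ i.succ) z) := by
    ext i j
    simp only [matDz, Matrix.of_apply, todaConnection_A01, subdiag, Matrix.sum_apply, dz_eq_wirt]
    rw [wirt_sum]
    · refine Finset.sum_congr rfl fun k _ => ?_
      simp only [Matrix.single_apply]
      split_ifs
      · rw [wirt_cexp ((hd _).fun_sub (hd _)), wirt_sub (hd _) (hd _)]
      · exact wirt_const _ _ _
    · intro k _
      simp only [Matrix.single_apply]
      split_ifs
      · exact ((hd _).fun_sub (hd _)).cexp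
      · exact differentiableAt_const _
  have h2 : matDzbar (todaConnection φ).A10 z = Matrix.diagonal (fun i => dz (dzbar (φ i)) z) := by
    ext i j
    simp only [matDzbar, Matrix.of_apply, todaConnection_A10, Matrix.add_apply]
    rcases eq_or_ne i j with rfl | hij
    · simp only [Matrix.diagonal_apply_eq]
      rw [dz_eq_wirt, dzbar_eq_wirt, wirt_comm hU (hφ i) hz, wirt_add _ (differentiableAt_const _),
        wirt_const, add_zero]
      exact differentiableAt_of_smooth hU (contDiffOn_wirt hU (hφ i) _) hz
    · simp only [Matrix.diagonal_apply_ne _ hij]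
      exact wirt_const _ _ _
  have h3 : Matrix.diagonal (fun i => dz (φ i) z) * subdiag (fun i => c i z) =
      subdiag fun i => dz (φ i.succ) z * c i z := by
    ext i j
    rw [Matrix.diagonal_mul]
    simp only [subdiag, Matrix.sum_apply, Finset.mul_sum, Matrix.single_apply]
    refine Finset.sum_congr rfl fun k _ => ?_
    split_ifs with h
    · rw [h.1]
    · rw [mul_zero]
  have h4 : subdiag (fun i => c i z) * Matrix.diagonal (fun i => dz (φ i) z) =
      subdiag fun i => c i z * dz (φ i.castSucc) z := by
    ext i j
    rw [Matrix.mul_diagonal]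
    simp only [subdiag, Matrix.sum_apply, Finset.sum_mul, Matrix.single_apply]
    refine Finset.sum_congr rfl fun k _ => ?_
    split_ifs with h
    · rw [h.2]
    · rw [zero_mul]
  have h5 : upShift r * subdiag (fun i => c i z) =
      ∑ i : Fin r, c i z • Matrix.single i.castSucc i.castSucc 1 := by
    simp only [upShift, Matrix.sum_mul]
    refine Finset.sum_congr rfl fun i _ => ?_
    rw [subdiag, Matrix.mul_sum, Finset.sum_eq_single i]
    · simp
    · intro k _ hk
      exact Matrix.single_mul_single_of_ne _ _ _ _ (by simpa using hk.symm) _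
    · simp
  have h6 : subdiag (fun i => c i z) * upShift r =
      ∑ i : Fin r, c i z • Matrix.single i.succ i.succ 1 := by
    simp only [subdiag, Matrix.sum_mul]
    refine Finset.sum_congr rfl fun i _ => ?_
    rw [upShift, Matrix.mul_sum, Finset.sum_eq_single i]
    · simp
    · intro k _ hk
      exact Matrix.single_mul_single_of_ne _ _ _ _ (by simpa using hk.symm) _
    · simp
  have h7 : (subdiag fun i => c i z * (dz (φ i.castSucc) z - dz (φ i.succ) z)) +
      (subdiag fun i => dz (φ i.succ) z * c i z) =
      subdiag fun i => c i z * dz (φ i.castSucc) z := by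
    simp only [subdiag, ← Finset.sum_add_distrib, ← Matrix.single_add]
    refine Finset.sum_congr rfl fun i _ => ?_
    congr 1
    ring
  rw [LocalConnection.curvature, h1, h2, todaConnection_A10, todaConnection_A01, Matrix.add_mul,
    Matrix.mul_add, h3, h4, h5, h6, ← h7]
  simp only [smul_sub, Finset.sum_sub_distrib]
  abel

theorem todaEquations_iff_flat (hU : IsOpen U) {φ : Fin (r + 1) → ℂ → ℂ}
    (hφ : ∀ i, ContDiffOn ℝ ∞ (φ i) U) :
    TodaEquations U φ ↔ ∀ z ∈ U, (todaConnection φ).curvature z = 0 := by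
  refine forall₂_congr fun z hz => ?_
  rw [curvature_toda hU hφ hz, sub_eq_zero]
  exact eq_comm

theorem curvature_toda_apply_ne (hU : IsOpen U) {φ : Fin (r + 1) → ℂ → ℂ}
    (hφ : ∀ i, ContDiffOn ℝ ∞ (φ i) U) (hz : z ∈ U) {i j : Fin (r + 1)} (hij : i ≠ j) :
    (todaConnection φ).curvature z i j = 0 := by
  rw [curvature_toda hU hφ hz, Matrix.sub_apply, Matrix.diagonal_apply_ne _ hij, sub_zero,
    Matrix.sum_apply]
  refine Finset.sum_eq_zero fun k _ => ?_
  rw [Matrix.smul_apply, Matrix.sub_apply, Matrix.single_apply_of_ne, Matrix.single_apply_of_ne]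
  · simp
  · rintro ⟨rfl, rfl⟩; exact hij rfl
  · rintro ⟨rfl, rfl⟩; exact hij rfl

/-! ### Necessity of the Toda equations -/

/-- The last row of `A G + ∂G = G W` expresses the `w`'s through the smooth functions `A`, `G`. -/
theorem contDiffOn_w_of_gauge (hU : IsOpen U) {A G : ℂ → Mat r} (hA : MatSmooth U A)
    (hG : MatSmooth U G) (hG1 : ∀ z ∈ U, G z (Fin.last r) (Fin.last r) = 1) {w : ℕ → ℂ → ℂ}
    (h : ∀ z ∈ U, A z * G z + matDz G z = G z * (wConnection r w).A10 z) (j : Fin r) :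
    ContDiffOn ℝ ∞ (w (r + 1 - j.val)) U := by
  have hs : MatSmooth U fun z => A z * G z + matDz G z - G z * upShift r := by
    rw [matDz_eq_matWirt]
    exact ((hA.mul hG).add (hG.matWirt hU _)).sub (hG.mul (matSmooth_const _))
  refine (hs (Fin.last r) j.castSucc).congr fun z hz => ?_
  simp only [Matrix.sub_apply]
  rw [h z hz, wConnection_A10, Matrix.mul_add, Matrix.add_apply, add_sub_cancel_left,
    mul_lastRow_castSucc, hG1 z hz, one_mul]

theorem matSmooth_orderedProd {G : Fin r → ℂ → SLn r}
    (hG : ∀ k, MatSmooth U fun z => (G k z).1) : MatSmooth U fun z => (orderedProd G z).1 := by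
  have key : ∀ l : List (ℂ → SLn r), (∀ g : ℂ → SLn r, g ∈ l → MatSmooth U fun z => (g z).1) →
      MatSmooth U fun z => ((l.map fun g : ℂ → SLn r => g z).prod).1 := by
    intro l
    induction l with
    | nil => exact fun _ => matSmooth_const _
    | cons g l ih =>
      intro h
      simp only [List.map_cons, List.prod_cons, Matrix.SpecialLinearGroup.coe_mul]
      exact (h g (by simp)).mul (ih fun g' hg' => h g' (by simp [hg']))
  have := key (List.ofFn G) (by simpa [List.forall_mem_ofFn_iff] using hG)
  simpa only [List.map_ofFn, orderedProd, Function.comp_def] using this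

theorem orderedProd_mem {G : Fin r → ℂ → SLn r} (hG : ∀ k, G k z ∈ lowerNilpotent r) :
    orderedProd G z ∈ lowerNilpotent r :=
  Subgroup.list_prod_mem _ ((List.forall_mem_ofFn_iff).2 hG)

/-- `F G = -G ∂̄W` with `F` diagonal, `G` lower unipotent and `∂̄W` concentrated in the last row
with vanishing last entry forces `F = 0`: both sides have only a last row, so only the last
diagonal entry of `F` can survive, and it is read off from the last column. -/
theorem diagonal_eq_zero_of_mul_eq {F : Mat r} (hF : ∀ i j, i ≠ j → F i j = 0) {g : SLn r}
    (hg : g ∈ lowerNilpotent r) {v : Fin r → ℂ} (h : F * g.1 = -(g.1 * lastRow v)) : F = 0 := by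
  have hlast : ∀ i, i ≠ Fin.last r → g.1 i (Fin.last r) = 0 := fun i hi =>
    hg.2 i _ (Fin.lt_last_iff_ne_last.2 hi)
  have hdiag : ∀ i j, (F * g.1) i j = F i i * g.1 i j := by
    intro i j
    rw [Matrix.mul_apply, Finset.sum_eq_single i]
    · intro k _ hk
      rw [hF i k hk.symm, zero_mul]
    · simp
  ext i j
  rcases eq_or_ne i j with rfl | hij
  · have h1 : (F * g.1) i i = F i i := by rw [hdiag, hg.1 i, mul_one]
    rw [← h1, h, Matrix.neg_apply, Matrix.zero_apply, neg_eq_zero]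
    induction i using Fin.lastCases with
    | last => exact mul_lastRow_last _ _ _
    | cast i =>
      rw [mul_lastRow_castSucc, hlast _ (Fin.castSucc_lt_last i).ne, zero_mul]
  · rw [hF i j hij, Matrix.zero_apply]

/-- `curvature_mul_gauge` for a gauge transformation of the Toda connection into W-form. -/
theorem curvature_toda_mul_gauge (hU : IsOpen U) {φ : Fin (r + 1) → ℂ → ℂ}
    (hφ : ∀ i, ContDiffOn ℝ ∞ (φ i) U) {G : ℂ → SLn r} (hG : MatSmooth U fun z => (G z).1)
    {w : ℕ → ℂ → ℂ} (hw : ∀ j : Fin r, ContDiffOn ℝ ∞ (w (r + 1 - j.val)) U)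
    (h : ((todaConnection φ).gauge G).EqOn (wConnection r w) U) (hz : z ∈ U) :
    (todaConnection φ).curvature z * (G z).1 =
      -((G z).1 * lastRow fun j => dzbar (w (r + 1 - j.val)) z) := by
  rw [gauge_eqOn_iff] at h
  rw [← matDzbar_wConnection]
  exact curvature_mul_gauge hU (matSmooth_toda_A10 hU hφ) (matSmooth_toda_A01 hφ) hG
    ((matSmooth_const (upShift r)).add (matSmooth_lastRow hw)) (fun z hz => (h z hz).1)
    (fun z hz => (h z hz).2.trans (Matrix.mul_zero _)) hz

theorem todaEquations_of_gauge (hU : IsOpen U) {φ : Fin (r + 1) → ℂ → ℂ}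
    (hφ : ∀ i, ContDiffOn ℝ ∞ (φ i) U) {G : ℂ → SLn r} (hG : MatSmooth U fun z => (G z).1)
    (hGl : ∀ z ∈ U, G z ∈ lowerNilpotent r) {w : ℕ → ℂ → ℂ}
    (h : ((todaConnection φ).gauge G).EqOn (wConnection r w) U) : TodaEquations U φ := by
  rw [todaEquations_iff_flat hU hφ]
  intro z hz
  have hw := contDiffOn_w_of_gauge hU (matSmooth_toda_A10 hU hφ) hG
    (fun z hz => (hGl z hz).1 _) fun z hz => (gauge_eqOn_iff.1 h z hz).1
  exact diagonal_eq_zero_of_mul_eq (fun i j => curvature_toda_apply_ne hU hφ hz) (hGl z hz)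
    (curvature_toda_mul_gauge hU hφ hG hw h hz)

/-! ### The rows of the gauge transformation -/

/-- The row `g` moved one place to the right, i.e. multiplied by the matrix with ones above the
diagonal. -/
def shiftRow (g : ℕ → ℂ → ℂ) : ℕ → ℂ → ℂ
  | 0, _ => 0
  | j + 1, z => g j z

/-- Rows `g_0, g_1, …` with `g_0 = (1, 0, 0, …)` and `g_{i+1} = shift g_i - (∂ + ∂φ_i) g_i`.
Rows and columns are numbered by all natural numbers, so that the recursion has no last case. -/
noncomputable def gaugeRow (φ : ℕ → ℂ → ℂ) : ℕ → ℕ → ℂ → ℂ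
  | 0, 0, _ => 1
  | 0, _ + 1, _ => 0
  | i + 1, j, z =>
    shiftRow (gaugeRow φ i) j z - dz (gaugeRow φ i j) z - dz (φ i) z * gaugeRow φ i j z

variable {φ : ℕ → ℂ → ℂ}

theorem gaugeRow_succ (φ : ℕ → ℂ → ℂ) (i j : ℕ) (z : ℂ) : gaugeRow φ (i + 1) j z =
    shiftRow (gaugeRow φ i) j z - dz (gaugeRow φ i j) z - dz (φ i) z * gaugeRow φ i j z := by
  rw [gaugeRow]

theorem gaugeRow_of_lt : ∀ {i j : ℕ}, i < j → gaugeRow φ i j = fun _ => 0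
  | 0, j + 1, _ => by funext z; rw [gaugeRow]
  | i + 1, j + 1, h => by
    funext z
    rw [gaugeRow_succ, shiftRow, gaugeRow_of_lt (show i < j by omega),
      gaugeRow_of_lt (show i < j + 1 by omega), dz_eq_wirt, wirt_const]
    ring

theorem gaugeRow_self : ∀ i : ℕ, gaugeRow φ i i = fun _ => 1
  | 0 => by funext z; rw [gaugeRow]
  | i + 1 => by
    funext z
    rw [gaugeRow_succ, shiftRow, gaugeRow_self i, gaugeRow_of_lt (Nat.lt_succ_self i),
      dz_eq_wirt, wirt_const]
    ring

/-- The entries below the diagonal are minus the partial sums of `∂φ_0, ∂φ_1, …`. -/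
theorem gaugeRow_succ_self (i : ℕ) (z : ℂ) :
    gaugeRow φ (i + 1) i z = -∑ k ∈ Finset.range (i + 1), dz (φ k) z := by
  induction i with
  | zero =>
    rw [gaugeRow_succ, shiftRow, gaugeRow_self, dz_eq_wirt, wirt_const]
    simp
  | succ i ih =>
    rw [gaugeRow_succ, shiftRow, ih, gaugeRow_self, Finset.sum_range_succ _ (i + 1), dz_eq_wirt,
      wirt_const]
    ring

theorem contDiffOn_shiftRow {g : ℕ → ℂ → ℂ} (hg : ∀ j, ContDiffOn ℝ ∞ (g j) U) :
    ∀ j, ContDiffOn ℝ ∞ (shiftRow g j) U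
  | 0 => contDiffOn_const (c := (0 : ℂ))
  | j + 1 => hg j

theorem contDiffOn_gaugeRow (hU : IsOpen U) (hφ : ∀ i, ContDiffOn ℝ ∞ (φ i) U) :
    ∀ i j, ContDiffOn ℝ ∞ (gaugeRow φ i j) U
  | 0, 0 => contDiffOn_const.congr fun z _ => by rw [gaugeRow]
  | 0, _ + 1 => contDiffOn_const.congr fun z _ => by rw [gaugeRow]
  | i + 1, j => by
    have ih := contDiffOn_gaugeRow hU hφ i
    refine (((contDiffOn_shiftRow ih j).sub (contDiffOn_wirt hU (ih j) (-Complex.I))).sub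
      ((contDiffOn_wirt hU (hφ i) (-Complex.I)).mul (ih j))).congr fun z _ => ?_
    rw [gaugeRow_succ, dz_eq_wirt]

theorem dzbar_shiftRow (g : ℕ → ℂ → ℂ) (j : ℕ) (z : ℂ) :
    dzbar (shiftRow g j) z = shiftRow (fun j => dzbar (g j)) j z := by
  cases j with
  | zero => exact wirt_const _ 0 z
  | succ j => rfl

theorem dzbar_gaugeRow_succ (hU : IsOpen U) (hφ : ∀ i, ContDiffOn ℝ ∞ (φ i) U) (hz : z ∈ U)
    (i j : ℕ) : dzbar (gaugeRow φ (i + 1) j) z =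
      shiftRow (fun j => dzbar (gaugeRow φ i j)) j z - dz (dzbar (gaugeRow φ i j)) z
        - (dz (dzbar (φ i)) z * gaugeRow φ i j z + dz (φ i) z * dzbar (gaugeRow φ i j) z) := by
  have hg := contDiffOn_gaugeRow hU hφ i
  have e : gaugeRow φ (i + 1) j = fun z =>
      shiftRow (gaugeRow φ i) j z - dz (gaugeRow φ i j) z - dz (φ i) z * gaugeRow φ i j z :=
    funext (gaugeRow_succ φ i j)
  have d1 := differentiableAt_of_smooth hU (contDiffOn_shiftRow hg j) hz
  have d2 := differentiableAt_of_smooth hU (contDiffOn_wirt hU (hg j) (-Complex.I)) hz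
  have d3 := differentiableAt_of_smooth hU (contDiffOn_wirt hU (hφ i) (-Complex.I)) hz
  have d4 := differentiableAt_of_smooth hU (hg j) hz
  rw [e, ← dzbar_shiftRow]
  simp only [dz_eq_wirt, dzbar_eq_wirt]
  rw [wirt_sub (d1.fun_sub d2) (d3.fun_mul d4), wirt_sub d1 d2, wirt_mul d3 d4,
    wirt_comm hU (hg j) hz Complex.I, wirt_comm hU (hφ i) hz Complex.I]

/-- The Toda equations make the rows satisfy `∂̄ g_{i+1} = -exp (φ_i - φ_{i+1}) g_i`. In the
inductive step, `(∂ + ∂φ_{i+1}) exp (φ_i - φ_{i+1}) = exp (φ_i - φ_{i+1}) (∂ + ∂φ_i)` as operators,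
so that the recursion for `g_{i+1}` reappears. -/
theorem dzbar_gaugeRow (hU : IsOpen U) (hφ : ∀ i, ContDiffOn ℝ ∞ (φ i) U)
    (h0 : 0 < r → ∀ z ∈ U, dz (dzbar (φ 0)) z = Complex.exp (φ 0 z - φ 1 z))
    (hs : ∀ i, i + 1 < r → ∀ z ∈ U, dz (dzbar (φ (i + 1))) z =
      Complex.exp (φ (i + 1) z - φ (i + 2) z) - Complex.exp (φ i z - φ (i + 1) z)) :
    ∀ i < r, ∀ j, ∀ z ∈ U, dzbar (gaugeRow φ (i + 1) j) z =
      -(Complex.exp (φ i z - φ (i + 1) z) * gaugeRow φ i j z) := by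
  intro i
  induction i with
  | zero =>
    intro hr j z hz
    have e : ∀ j z, dzbar (gaugeRow φ 0 j) z = 0 := by
      intro j z
      rcases Nat.eq_zero_or_pos j with rfl | hj
      · rw [gaugeRow_self]; exact wirt_const _ _ _
      · rw [gaugeRow_of_lt hj]; exact wirt_const _ _ _
    have e1 : shiftRow (fun j => dzbar (gaugeRow φ 0 j)) j z = 0 := by
      cases j with
      | zero => rfl
      | succ j => exact e j z
    have e2 : dz (dzbar (gaugeRow φ 0 j)) z = 0 := by
      rw [funext (e j), dz_eq_wirt, wirt_const]
    rw [dzbar_gaugeRow_succ hU hφ hz, e1, e2, e, h0 hr z hz]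
    ring
  | succ i ih =>
    intro hr j z hz
    have ih := ih (by omega)
    have d1 := differentiableAt_of_smooth hU (hφ i) hz
    have d2 := differentiableAt_of_smooth hU (hφ (i + 1)) hz
    have d3 := differentiableAt_of_smooth hU (contDiffOn_gaugeRow hU hφ i j) hz
    have e1 : shiftRow (fun j => dzbar (gaugeRow φ (i + 1) j)) j z =
        -(Complex.exp (φ i z - φ (i + 1) z) * shiftRow (gaugeRow φ i) j z) := by
      cases j with
      | zero => simp [shiftRow]
      | succ j => exact ih j z hz
    have e2 : dz (dzbar (gaugeRow φ (i + 1) j)) z =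
        -(Complex.exp (φ i z - φ (i + 1) z) * (dz (φ i) z - dz (φ (i + 1)) z) * gaugeRow φ i j z
          + Complex.exp (φ i z - φ (i + 1) z) * dz (gaugeRow φ i j) z) := by
      rw [dz_eq_wirt, wirt_congr hU hz (ih j), wirt_neg, wirt_mul (d1.fun_sub d2).cexp d3,
        wirt_cexp (d1.fun_sub d2), wirt_sub d1 d2]
    rw [dzbar_gaugeRow_succ hU hφ hz, e1, e2, ih j z hz, hs i hr z hz, gaugeRow_succ φ i j]
    ring

/-! ### Products and exponentials of column gauges -/

theorem exp_eq_one_add {N : Mat r} (hN : N * N = 0) : NormedSpace.exp N = 1 + N := by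
  rw [NormedSpace.exp_eq_tsum ℂ]
  beta_reduce
  rw [tsum_eq_sum (s := Finset.range 2)]
  · simp [Finset.sum_range_succ]
  · intro n hn
    obtain ⟨k, rfl⟩ : ∃ k, n = 2 + k := ⟨n - 2, by simp at hn; omega⟩
    rw [pow_add, pow_two, hN, zero_mul, smul_zero]

theorem list_prod_one_add {R : Type*} [Ring R] :
    ∀ l : List R, l.Pairwise (fun x y => x * y = 0) → (l.map fun x => 1 + x).prod = 1 + l.sum
  | [], _ => by simp
  | x :: l, h => by
    rw [List.pairwise_cons] at h
    have h0 : x * l.sum = 0 := by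
      rw [← List.map_id l, ← List.sum_map_mul_left]
      exact List.sum_eq_zero (by simpa using h.1)
    rw [List.map_cons, List.prod_cons, List.sum_cons, list_prod_one_add l h.2, add_mul, mul_add x,
      h0, one_mul, mul_one, add_zero]
    abel

/-- The `k`-th column of `M` below the diagonal. -/
def columnPart (M : Mat r) (k : Fin r) : Mat r :=
  ∑ j ∈ Finset.Ioi k.castSucc, Matrix.single j k.castSucc (M j k.castSucc)

theorem columnPart_apply (M : Mat r) (k : Fin r) (i j : Fin (r + 1)) :
    columnPart M k i j = if j = k.castSucc ∧ j < i then M i j else 0 := by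
  rw [columnPart, Matrix.sum_apply]
  split_ifs with h
  · obtain ⟨rfl, h⟩ := h
    rw [Finset.sum_eq_single i]
    · simp
    · intro l _ hl
      exact Matrix.single_apply_of_row_ne hl _ _ _
    · intro hi
      exact absurd (Finset.mem_Ioi.2 h) hi
  · refine Finset.sum_eq_zero fun l hl => Matrix.single_apply_of_ne _ _ _ _ _ ?_
    rintro ⟨rfl, rfl⟩
    exact h ⟨rfl, Finset.mem_Ioi.1 hl⟩

theorem columnPart_mul_columnPart (M : Mat r) {k l : Fin r} (h : k ≤ l) :
    columnPart M k * columnPart M l = 0 := by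
  ext i j
  rw [Matrix.mul_apply, Matrix.zero_apply]
  refine Finset.sum_eq_zero fun m _ => ?_
  rw [columnPart_apply, columnPart_apply]
  split_ifs with h1 h2
  · obtain ⟨rfl, -⟩ := h1
    obtain ⟨rfl, h2⟩ := h2
    exact absurd (Fin.castSucc_lt_castSucc_iff.1 h2) (not_lt.2 h)
  all_goals simp

theorem sum_columnPart (M : Mat r) (h1 : ∀ i, M i i = 1) (h0 : ∀ i j, i < j → M i j = 0) :
    1 + ∑ k, columnPart M k = M := by
  ext i j
  rw [Matrix.add_apply, Matrix.sum_apply]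
  simp only [columnPart_apply]
  rcases lt_trichotomy i j with h | rfl | h
  · rw [h0 i j h, Matrix.one_apply_ne h.ne, zero_add]
    exact Finset.sum_eq_zero fun k _ => if_neg fun hk => lt_asymm h hk.2
  · rw [h1 i, Matrix.one_apply_eq, add_eq_left]
    exact Finset.sum_eq_zero fun k _ => if_neg fun hk => lt_irrefl _ hk.2
  · obtain ⟨k, rfl⟩ := Fin.exists_castSucc_eq.2 (h.trans_le (Fin.le_last i)).ne
    rw [Matrix.one_apply_ne h.ne', zero_add, Finset.sum_eq_single k]
    · exact if_pos ⟨rfl, h⟩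
    · intro l _ hl
      exact if_neg fun hk => hl (Fin.castSucc_injective _ hk.1).symm
    · simp

/-- A lower unipotent matrix as an element of the special linear group. -/
def unipotentSL (M : Mat r) (h1 : ∀ i, M i i = 1) (h0 : ∀ i j, i < j → M i j = 0) : SLn r :=
  ⟨M, by
    rw [Matrix.det_of_isLowerTriangular M fun i j hij => h0 i j hij]
    simp [h1]⟩

theorem one_add_columnPart_diag (M : Mat r) (k : Fin r) (i : Fin (r + 1)) :
    (1 + columnPart M k) i i = 1 := by
  simp [columnPart_apply]

theorem one_add_columnPart_upper (M : Mat r) (k : Fin r) (i j : Fin (r + 1)) (h : i < j) :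
    (1 + columnPart M k) i j = 0 := by
  rw [Matrix.add_apply, Matrix.one_apply_ne h.ne, columnPart_apply,
    if_neg fun hk => lt_asymm h hk.2, add_zero]

/-- The gauge transformation agreeing with `M` in the `k`-th column and with `1` elsewhere. -/
def columnGauge (M : ℂ → Mat r) (k : Fin r) (z : ℂ) : SLn r :=
  unipotentSL (1 + columnPart (M z) k) (one_add_columnPart_diag _ _)
    (one_add_columnPart_upper _ _)

theorem coe_columnGauge (M : ℂ → Mat r) (k : Fin r) (z : ℂ) :
    (columnGauge M k z).1 = 1 + columnPart (M z) k := rfl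

/-- A lower unipotent matrix is the product of its columns, in increasing order. -/
theorem coe_orderedProd_columnGauge {M : ℂ → Mat r} (h1 : ∀ i, M z i i = 1)
    (h0 : ∀ i j, i < j → M z i j = 0) : (orderedProd (columnGauge M) z).1 = M z := by
  have e : (orderedProd (columnGauge M) z).1 =
      ((List.ofFn (columnPart (M z))).map fun x => 1 + x).prod := by
    refine (map_list_prod (Matrix.SpecialLinearGroup.coeMonoidHom (ι := Fin (r + 1)) (R := ℂ))
      (List.ofFn fun k => columnGauge M k z)).trans ?_
    rw [List.map_ofFn, List.map_ofFn]
    rfl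
  rw [e, list_prod_one_add, List.sum_ofFn, sum_columnPart _ h1 h0]
  rw [List.pairwise_ofFn]
  exact fun k l h => columnPart_mul_columnPart _ h.le

theorem isColumnGauge_columnGauge {M : ℂ → Mat r} (hM : MatSmooth U M) (k : Fin r) :
    IsColumnGauge U k (columnGauge M k) :=
  ⟨fun j z => M z j k.castSucc, fun j => hM j _, fun z _ => by
    rw [coe_columnGauge]
    exact (exp_eq_one_add (columnPart_mul_columnPart (M z) le_rfl)).symm⟩

theorem isLowerNilpotentGauge_columnGauge {M : ℂ → Mat r} (hM : MatSmooth U M) (k : Fin r) :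
    IsLowerNilpotentGauge U (columnGauge M k) := by
  refine ⟨fun i j => ?_, fun z _ =>
    ⟨one_add_columnPart_diag (M z) k, one_add_columnPart_upper (M z) k⟩⟩
  simp only [coe_columnGauge, Matrix.add_apply, columnPart_apply]
  split_ifs
  · exact contDiffOn_const.add (hM i j)
  · exact contDiffOn_const

/-! ### Solutions of the Toda equations -/

theorem todaEquations_castSucc {φ : Fin (r + 1) → ℂ → ℂ} (h : TodaEquations U φ) (hz : z ∈ U)
    (i : Fin r) : dz (dzbar (φ i.castSucc)) z =
      Complex.exp (φ i.castSucc z - φ i.succ z) -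
        ∑ k : Fin r, if k.succ = i.castSucc then Complex.exp (φ k.castSucc z - φ k.succ z)
          else 0 := by
  have := congrFun (congrFun (h z hz) i.castSucc) i.castSucc
  rw [Matrix.diagonal_apply_eq, Matrix.sum_apply] at this
  simpa [Matrix.single_apply, mul_sub, Finset.sum_sub_distrib] using this

/-- The matrix of the rows `gaugeRow`; `Fin.ofNat` extends the family `φ` to all natural
indices, and the values outside the range of `Fin (r + 1)` do not matter. -/
noncomputable def gaugeMatrix (φ : Fin (r + 1) → ℂ → ℂ) (z : ℂ) : Mat r :=
  Matrix.of fun i j => gaugeRow (fun k => φ (Fin.ofNat (r + 1) k)) i j z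

theorem gaugeMatrix_diag (φ : Fin (r + 1) → ℂ → ℂ) (z : ℂ) (i : Fin (r + 1)) :
    gaugeMatrix φ z i i = 1 := by
  rw [gaugeMatrix, Matrix.of_apply, gaugeRow_self]

theorem gaugeMatrix_upper (φ : Fin (r + 1) → ℂ → ℂ) (z : ℂ) (i j : Fin (r + 1)) (h : i < j) :
    gaugeMatrix φ z i j = 0 := by
  rw [gaugeMatrix, Matrix.of_apply, gaugeRow_of_lt h]

theorem matSmooth_gaugeMatrix (hU : IsOpen U) {φ : Fin (r + 1) → ℂ → ℂ}
    (hφ : ∀ i, ContDiffOn ℝ ∞ (φ i) U) : MatSmooth U (gaugeMatrix φ) :=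
  fun i j => contDiffOn_gaugeRow hU (fun k => hφ (Fin.ofNat (r + 1) k)) i j

theorem ofNat_castSucc (i : Fin r) : Fin.ofNat (r + 1) i = i.castSucc :=
  Fin.cast_val_eq_self i.castSucc

theorem ofNat_succ (i : Fin r) : Fin.ofNat (r + 1) (i + 1) = i.succ :=
  Fin.cast_val_eq_self i.succ

/-- The equation `B G + ∂̄ G = 0`. -/
theorem toda_A01_mul_gaugeMatrix (hU : IsOpen U) {φ : Fin (r + 1) → ℂ → ℂ}
    (hφ : ∀ i, ContDiffOn ℝ ∞ (φ i) U) (h : TodaEquations U φ) (hz : z ∈ U) :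
    (todaConnection φ).A01 z * gaugeMatrix φ z + matDzbar (gaugeMatrix φ) z = 0 := by
  have key := dzbar_gaugeRow (r := r) hU (fun k => hφ (Fin.ofNat (r + 1) k)) ?_ ?_
  · ext i j
    rw [todaConnection_A01, Matrix.add_apply, Matrix.zero_apply, matDzbar, Matrix.of_apply]
    induction i using Fin.cases with
    | zero =>
      rw [subdiag_mul_zero, zero_add]
      have : (fun x => gaugeMatrix φ x 0 j) = fun _ => if (j : ℕ) = 0 then 1 else 0 := by
        funext x
        split_ifs with hj
        · obtain rfl : j = 0 := Fin.ext hj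
          exact gaugeMatrix_diag φ x 0
        · exact gaugeMatrix_upper φ x 0 j (Nat.pos_of_ne_zero hj)
      rw [this]
      exact wirt_const _ _ _
    | succ i =>
      have := key i i.2 j z hz
      rw [ofNat_castSucc, ofNat_succ] at this
      rw [subdiag_mul_succ]
      exact (congrArg _ this).trans (add_neg_cancel _)
  · intro hr z hz
    have := todaEquations_castSucc h hz ⟨0, hr⟩
    rw [Finset.sum_eq_zero, sub_zero] at this
    · rw [← ofNat_castSucc, ← ofNat_succ] at this
      exact this
    · exact fun k _ => if_neg (Fin.succ_ne_zero k)
  · intro i hi z hz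
    have := todaEquations_castSucc h hz ⟨i + 1, hi⟩
    rw [Finset.sum_eq_single ⟨i, by omega⟩, if_pos (by rfl)] at this
    · simp only [← ofNat_castSucc, ← ofNat_succ] at this
      exact this
    · intro k _ hk
      refine if_neg fun hk' => hk (Fin.ext ?_)
      simpa using congrArg Fin.val hk'
    · simp

/-- The functions `w` read off from the last row of `A G + ∂G = G W`; column `j` of that row gives
`w_m` for `m = r + 1 - j`. -/
noncomputable def gaugeW (φ : Fin (r + 1) → ℂ → ℂ) (m : ℕ) (z : ℂ) : ℂ :=
  let j := Fin.ofNat (r + 1) (r + 1 - m)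
  dz (φ (Fin.last r)) z * gaugeMatrix φ z (Fin.last r) j
    + dz (fun x => gaugeMatrix φ x (Fin.last r) j) z
    - (gaugeMatrix φ z * upShift r) (Fin.last r) j

/-- The equation `A G + ∂G = G W`. All rows but the last are the recursion defining `gaugeRow`,
and the last row defines `w`, except for its last entry, which is the vanishing of
`∑ i, ∂φ_i`. -/
theorem toda_A10_mul_gaugeMatrix (hU : IsOpen U) {φ : Fin (r + 1) → ℂ → ℂ}
    (hφ : ∀ i, ContDiffOn ℝ ∞ (φ i) U) (hsum : ∀ z ∈ U, ∑ i, φ i z = 0) (hz : z ∈ U) :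
    (todaConnection φ).A10 z * gaugeMatrix φ z + matDz (gaugeMatrix φ) z =
      gaugeMatrix φ z * (wConnection r (gaugeW φ)).A10 z := by
  have hshift : ∀ i j, (gaugeMatrix φ z * upShift r) i j =
      shiftRow (gaugeRow (fun k => φ (Fin.ofNat (r + 1) k)) i) j z := by
    intro i j
    induction j using Fin.cases with
    | zero => rw [mul_upShift_zero]; rfl
    | succ j => rw [mul_upShift_succ]; rfl
  ext i j
  rw [todaConnection_A10, wConnection_A10, Matrix.add_mul, Matrix.mul_add, Matrix.add_apply,
    Matrix.add_apply, Matrix.add_apply, Matrix.diagonal_mul, matDz, Matrix.of_apply]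
  induction i using Fin.lastCases with
  | last =>
    rw [upShift_mul_last, add_zero]
    induction j using Fin.lastCases with
    | last =>
      have e1 : (fun x => gaugeMatrix φ x (Fin.last r) (Fin.last r)) = fun _ => 1 :=
        funext fun x => gaugeMatrix_diag φ x _
      have e2 : (gaugeMatrix φ z * upShift r) (Fin.last r) (Fin.last r) =
          -∑ k : Fin r, dz (φ k.castSucc) z := by
        rw [hshift]
        cases r with
        | zero => simp [shiftRow]
        | succ r =>
          refine (gaugeRow_succ_self r z).trans ?_
          rw [Finset.sum_range]
          simp only [ofNat_castSucc]
      have e3 : ∑ k, dz (φ k) z = 0 := by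
        rw [dz_eq_wirt, ← wirt_sum _ fun i _ => differentiableAt_of_smooth hU (hφ i) hz,
          wirt_congr hU hz hsum, wirt_const]
      rw [Fin.sum_univ_castSucc] at e3
      rw [e1, gaugeMatrix_diag, e2, mul_lastRow_last, dz_eq_wirt, wirt_const]
      rw [dz_eq_wirt] at e3
      linear_combination e3
    | cast j =>
      rw [mul_lastRow_castSucc, gaugeMatrix_diag, gaugeW]
      have : Fin.ofNat (r + 1) (r + 1 - (r + 1 - (j : ℕ))) = j.castSucc := by
        rw [Nat.sub_sub_self (by omega), ofNat_castSucc]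
      rw [this]
      ring
  | cast i =>
    have e : (gaugeMatrix φ z * lastRow (fun j : Fin r => gaugeW φ (r + 1 - j.val) z))
        i.castSucc j = 0 := by
      induction j using Fin.lastCases with
      | last => exact mul_lastRow_last _ _ _
      | cast j =>
        rw [mul_lastRow_castSucc, gaugeMatrix_upper _ _ _ _ (Fin.castSucc_lt_last i), zero_mul]
    have e1 : gaugeMatrix φ z i.succ j = (gaugeMatrix φ z * upShift r) i.castSucc j
        - dz (fun x => gaugeMatrix φ x i.castSucc j) z
        - dz (φ i.castSucc) z * gaugeMatrix φ z i.castSucc j := by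
      rw [hshift]
      refine (gaugeRow_succ _ i j z).trans ?_
      rw [ofNat_castSucc]
      rfl
    rw [e, upShift_mul_castSucc, e1]
    ring

/-- The curvature of the connection in W-form vanishes along with that of the Toda connection. -/
theorem dzbar_w_of_gauge (hU : IsOpen U) {φ : Fin (r + 1) → ℂ → ℂ}
    (hφ : ∀ i, ContDiffOn ℝ ∞ (φ i) U) (h : TodaEquations U φ) {G : ℂ → SLn r}
    (hG : MatSmooth U fun z => (G z).1) {w : ℕ → ℂ → ℂ}
    (hw : ∀ j : Fin r, ContDiffOn ℝ ∞ (w (r + 1 - j.val)) U)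
    (hD : ((todaConnection φ).gauge G).EqOn (wConnection r w) U) (hz : z ∈ U) (j : Fin r) :
    dzbar (w (r + 1 - j.val)) z = 0 := by
  have key := curvature_toda_mul_gauge hU hφ hG hw hD hz
  rw [(todaEquations_iff_flat hU hφ).1 h z hz, Matrix.zero_mul, eq_comm, neg_eq_zero] at key
  have h0 : (lastRow fun j : Fin r => dzbar (w (r + 1 - j.val)) z) = 0 := by
    rw [← Matrix.one_mul (lastRow _), ← Matrix.SpecialLinearGroup.coe_one, ← inv_mul_cancel (G z),
      Matrix.SpecialLinearGroup.coe_mul, Matrix.mul_assoc]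
    exact (congrArg _ key).trans (Matrix.mul_zero _)
  rw [← lastRow_apply_castSucc (fun j : Fin r => dzbar (w (r + 1 - j.val)) z) j, h0,
    Matrix.zero_apply]

theorem exists_gauge_of_todaEquations (hU : IsOpen U) {φ : Fin (r + 1) → ℂ → ℂ}
    (hφ : ∀ i, ContDiffOn ℝ ∞ (φ i) U) (hsum : ∀ z ∈ U, ∑ i, φ i z = 0)
    (h : TodaEquations U φ) :
    ∃ (G : Fin r → ℂ → SLn r) (w : ℕ → ℂ → ℂ),
      (∀ k, IsLowerNilpotentGauge U (G k)) ∧ (∀ k, IsColumnGauge U k (G k)) ∧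
      (∀ i ∈ Finset.Icc 2 (r + 1), DifferentiableOn ℂ (w i) U) ∧
      ((todaConnection φ).gauge (orderedProd G)).EqOn (wConnection r w) U := by
  have hM := matSmooth_gaugeMatrix hU hφ
  have hG : ∀ z, (orderedProd (columnGauge (gaugeMatrix φ)) z).1 = gaugeMatrix φ z := fun z =>
    coe_orderedProd_columnGauge (gaugeMatrix_diag φ z) (gaugeMatrix_upper φ z)
  have h10 := fun z (hz : z ∈ U) => toda_A10_mul_gaugeMatrix hU hφ hsum hz
  have hD : ((todaConnection φ).gauge (orderedProd (columnGauge (gaugeMatrix φ)))).EqOn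
      (wConnection r (gaugeW φ)) U := by
    rw [gauge_eqOn_iff]
    simp only [hG]
    exact fun z hz => ⟨h10 z hz,
      (toda_A01_mul_gaugeMatrix hU hφ h hz).trans (Matrix.mul_zero _).symm⟩
  have hw := contDiffOn_w_of_gauge hU (matSmooth_toda_A10 hU hφ) hM
    (fun z _ => gaugeMatrix_diag φ z _) h10
  refine ⟨columnGauge (gaugeMatrix φ), gaugeW φ, isLowerNilpotentGauge_columnGauge hM,
    isColumnGauge_columnGauge hM, fun m hm => ?_, hD⟩
  obtain ⟨h2, hr⟩ := Finset.mem_Icc.1 hm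
  obtain ⟨j, rfl⟩ : ∃ j : Fin r, m = r + 1 - j.val := ⟨⟨r + 1 - m, by omega⟩, by simp; omega⟩
  exact differentiableOn_of_dzbar_eq_zero hU (hw j) fun z hz =>
    dzbar_w_of_gauge hU hφ h (by simpa only [hG] using hM) hw hD hz j

end Toda

theorem mainTheorem5 (r : ℕ) (U : Set ℂ) (hU : IsOpen U)
    (φ : Fin (r + 1) → ℂ → ℂ) (hφ : ∀ i, ContDiffOn ℝ ∞ (φ i) U)
    (hsum : ∀ z ∈ U, ∑ i, φ i z = 0) :
    -- a solution of the Toda equations is mapped to a holomorphic connection in W-form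
    (Toda.TodaEquations U φ →
      ∃ (G : Fin r → ℂ → Toda.SLn r) (w : ℕ → ℂ → ℂ),
        (∀ k, Toda.IsLowerNilpotentGauge U (G k)) ∧
        (∀ k, Toda.IsColumnGauge U k (G k)) ∧
        (∀ i ∈ Finset.Icc 2 (r + 1), DifferentiableOn ℂ (w i) U) ∧
        ((Toda.todaConnection φ).gauge (Toda.orderedProd G)).EqOn (Toda.wConnection r w) U) ∧
    -- the Toda equations are necessary for the system to have a solution
    (∀ (G : Fin r → ℂ → Toda.SLn r) (w : ℕ → ℂ → ℂ),
      (∀ k, Toda.IsLowerNilpotentGauge U (G k)) →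
      ((Toda.todaConnection φ).gauge (Toda.orderedProd G)).EqOn (Toda.wConnection r w) U →
      Toda.TodaEquations U φ) ∧
    -- the Toda equations are the flatness of the Toda connection
    (Toda.TodaEquations U φ ↔ ∀ z ∈ U, (Toda.todaConnection φ).curvature z = 0) :=
  ⟨Toda.exists_gauge_of_todaEquations hU hφ hsum,
    fun _ _ hG h => Toda.todaEquations_of_gauge hU hφ
      (Toda.matSmooth_orderedProd fun k => (hG k).1)
      (fun z hz => Toda.orderedProd_mem fun k => (hG k).2 z hz) h,
    Toda.todaEquations_iff_flat hU hφ⟩
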